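/- All logarithms are to base $2$, except $\ln$. A projective measurement of a qubit is given by an orthonormal basis of $\mathbb{C}^2$. For a string $q$ of bits and $a\in\{0,1\}$ let $w_a(q)=|\{i: q_i\ne a\}|/|q|$. Let $\bar H(x)=0$ for $x<0$, $\bar H(x)=-x\log x-(1-x)\log(1-x)$ for $0\le x\le 1/2$ (with $0\log 0=0$), and $\bar H(x)=1$ for $x>1/2$. For a density operator $\rho$ let $H_\infty(\rho)=\max\{\lambda\in\mathbb{R}: 2^{-\lambda}I-\rho\ge 0\}$. For a qubit measurement $N$ and a density operator $\rho$ on several qubits, let $H_\infty(N)_\rho$ be the min-entropy $H_\infty$ of the state obtained from $\rho$ by measuring every qubit with $N$, and for $\eta\ge 0$ let $H^{\eta}_\infty(N)_\rho=\sup H_\infty(N)_\sigma$, the supremum over all density operators $\sigma$ with $\|\sigma-\rho\|\le\eta$, where $\|A\|=\operatorname{tr}\sqrt{A^\dagger A}$. **Theorem 1.** Let $1\le m\le n$ be integers, $\hat\epsilon\ge\epsilon>0$, $a\in\{0,1\}$, $0<\beta<1/2$, let $\rho$ be any density operator on $(\mathbb{C}^2)^{\otimes(m+n)}$ (possibly not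 i.i.d.), and let $M=\{|\mu_0\rangle\langle\mu_0|,|\mu_1\rangle\langle\mu_1|\}$ and $N=\{|\nu_0\rangle\langle\nu_0|,|\nu_1\rangle\langle\nu_1|\}$ be two projective measurements of a qubit. Choose a subset $t$ of $m$ of the $m+n$ qubits uniformly at random, measure each qubit in $t$ with $M$, let $q\in\{0,1\}^m$ be the outcome, and let $\rho(t,q)$ be the post-measurement state of the remaining $n$ qubits. Then $$\Pr\Big[H_\infty^{2\epsilon+2\epsilon^\beta}(N)_{\rho(t,q)}+n\,\bar H\big(w_a(q)+\delta\big)\ \ge\ -n\log c\Big]\ \ge\ 1-\hat\epsilon^{\,1-2\beta},$$ where the probability is over the choice of $t$ and the measurement outcome $q$, $c=\max_{x,y}|\langle\mu_x|\nu_y\rangle|^2$, and $$\delta=\sqrt{\frac{(m+n+2)\ln(2/\epsilon^2)}{m(m+n)}}$$ (for $\epsilon^2>2$, where the root is not real, read $\delta=0$; the claim is then trivial). -/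

import Mathlib

noncomputable section

open scoped ComplexOrder

namespace QuantumSampling

/-- Relative `a`-Hamming weight of a string `q` of bits indexed by `κ`: the number of letters
different from `a`, divided by the length of the string. -/
def relWeight {κ : Type*} [Fintype κ] (a : Fin 2) (q : κ → Fin 2) : ℝ :=
  ((Finset.univ.filter fun i => q i ≠ a).card : ℝ) / (Fintype.card κ : ℝ)

/-- Extended binary entropy (base 2): `0` for `x < 0`, the binary Shannon entropy on `[0, 1/2]`,
and `1` for `x > 1/2`. -/
def extBinEntropy (x : ℝ) : ℝ :=
  if x < 0 then 0 else if x ≤ 1 / 2 then Real.binEntropy x / Real.log 2 else 1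

/-- Operators on the space of the qubits labelled by `κ`, as matrices in the computational basis,
which is indexed by the bit strings `κ → Fin 2`. -/
abbrev QubitOp (κ : Type*) : Type _ := Matrix (κ → Fin 2) (κ → Fin 2) ℂ

/-- Density operators: positive semidefinite, of unit trace. -/
def IsDensity {κ : Type*} [Fintype κ] [DecidableEq κ] (ρ : QubitOp κ) : Prop :=
  ρ.PosSemidef ∧ ρ.trace = 1

/-- A projective measurement of a qubit is given by an orthonormal basis of `ℂ²`. -/
abbrev QubitPM : Type := OrthonormalBasis (Fin 2) ℂ (EuclideanSpace ℂ (Fin 2))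

/-- The maximal overlap `c = max_{x,y} |⟨μ_x|ν_y⟩|²`. -/
def overlap (M N : QubitPM) : ℝ :=
  Finset.univ.sup' Finset.univ_nonempty
    fun p : Fin 2 × Fin 2 => ‖inner ℂ (M p.1) (N p.2)‖ ^ 2

/-- Coordinates of the product vector `⊗_i |φ_{j_i}⟩`. -/
def prodVec {κ : Type*} [Fintype κ] (N : QubitPM) (j : κ → Fin 2) : (κ → Fin 2) → ℂ :=
  fun x => ∏ i, N (j i) (x i)

/-- The state `∑_j ⟨φ_j|ρ|φ_j⟩ |φ_j⟩⟨φ_j|` that results from measuring every qubit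
with `N`. -/
def measured {κ : Type*} [Fintype κ] [DecidableEq κ] (N : QubitPM) (ρ : QubitOp κ) : QubitOp κ :=
  ∑ j : κ → Fin 2, (star (prodVec N j) ⬝ᵥ (ρ.mulVec (prodVec N j))) •
    Matrix.vecMulVec (prodVec N j) (star (prodVec N j))

/-- Min-entropy `max {l | 2^{-l} I - ρ ≥ 0}`, that is `-log₂ λ_max(ρ)`. -/
def minEntropy {κ : Type*} [Fintype κ] [DecidableEq κ] (ρ : QubitOp κ) : ℝ :=
  sSup {l : ℝ | ((((2 : ℝ) ^ (-l) : ℝ) : ℂ) • (1 : QubitOp κ) - ρ).PosSemidef}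

/-- `H_∞(N)_ρ`: min-entropy of the state obtained by measuring each qubit of `ρ` with `N`. -/
def minEntropyPM {κ : Type*} [Fintype κ] [DecidableEq κ] (N : QubitPM) (ρ : QubitOp κ) : ℝ :=
  minEntropy (measured N ρ)

/-- Trace norm: the sum of the singular values, `tr √(A† A)`. -/
def traceNorm {κ : Type*} [Fintype κ] [DecidableEq κ] (A : QubitOp κ) : ℝ :=
  ∑ i, √((Matrix.isHermitian_conjTranspose_mul_self A).eigenvalues i)

/-- `Γ_η(ρ)`: the density operators within trace-norm distance `η` of `ρ`. -/
def densityBall {κ : Type*} [Fintype κ] [DecidableEq κ] (η : ℝ) (ρ : QubitOp κ) :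
    Set (QubitOp κ) :=
  {σ | IsDensity σ ∧ traceNorm (σ - ρ) ≤ η}

/-- `H_∞^η(N)_ρ`: the supremum of `H_∞(N)_σ` over `σ ∈ Γ_η(ρ)`. -/
def smoothMinEntropyPM {κ : Type*} [Fintype κ] [DecidableEq κ] (η : ℝ) (N : QubitPM)
    (ρ : QubitOp κ) : ℝ :=
  sSup (minEntropyPM N '' densityBall η ρ)

/-- The string that equals `u` on the positions in `t` and `x` on the other positions. -/
def glue {ι : Type*} [DecidableEq ι] (t : Finset ι) (u : {i // i ∈ t} → Fin 2)
    (x : {i // i ∉ t} → Fin 2) : ι → Fin 2 :=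
  fun i => if h : i ∈ t then u ⟨i, h⟩ else x ⟨i, h⟩

/-- The unnormalized state `(⟨μ_q| ⊗ I) ρ (|μ_q⟩ ⊗ I)` of the qubits outside `t`, after the qubits
in `t` were measured with `M` and outcome `q` was observed. -/
def subnormPost {ι : Type*} [Fintype ι] [DecidableEq ι] (M : QubitPM) (ρ : QubitOp ι)
    (t : Finset ι) (q : {i // i ∈ t} → Fin 2) : QubitOp {i // i ∉ t} :=
  fun x y => ∑ u, ∑ v,
    star (prodVec M q u) * ρ (glue t u x) (glue t v y) * prodVec M q v

/-- `p(q|t)`: the probability of outcome `q` when the qubits in `t` are measured with `M`. -/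
def outcomeProb {ι : Type*} [Fintype ι] [DecidableEq ι] (M : QubitPM) (ρ : QubitOp ι)
    (t : Finset ι) (q : {i // i ∈ t} → Fin 2) : ℝ :=
  (subnormPost M ρ t q).trace.re

/-- The post-measurement state `ρ(t,q)` of the qubits outside `t`; it is meaningful for outcomes
of positive probability. -/
def postState {ι : Type*} [Fintype ι] [DecidableEq ι] (M : QubitPM) (ρ : QubitOp ι)
    (t : Finset ι) (q : {i // i ∈ t} → Fin 2) : QubitOp {i // i ∉ t} :=
  ((outcomeProb M ρ t q : ℂ))⁻¹ • subnormPost M ρ t q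

open Classical in
/-- Probability of the event `E t q` when `t` is a uniformly random set of `m` of the qubits of `ρ`
and `q` is the outcome of measuring the qubits in `t` with `M`. -/
def sampleProb {ι : Type*} [Fintype ι] [DecidableEq ι] (m : ℕ) (M : QubitPM) (ρ : QubitOp ι)
    (E : (t : Finset ι) → ({i // i ∈ t} → Fin 2) → Prop) : ℝ :=
  ∑ t ∈ Finset.powersetCard m (Finset.univ : Finset ι),
    ((Fintype.card ι).choose m : ℝ)⁻¹ * ∑ q, if E t q then outcomeProb M ρ t q else 0

/-- The sampling accuracy `δ`, with natural logarithm. -/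
def samplingDelta (m n : ℕ) (ε : ℝ) : ℝ :=
  √((((m : ℝ) + n + 2) * Real.log (2 / ε ^ 2)) / ((m : ℝ) * ((m : ℝ) + n)))

end QuantumSampling

end

/-!
The theorem reduces to two facts, one classical and one about trace norms.

Measuring all `m + n` qubits of `ρ` with `M` gives a random string `j`, and the outcome `q` on the
sample `t` is its restriction to `t`. Serfling's inequality (`sum_exp_card_filter_le`) shows that,
whatever `j` is, the relative weight of `j` outside `t` exceeds `w_a(q) + δ` with probability at
most `ε²` over `t` (`card_bad_samples_le`). The probability `x(t,q)` that measuring `ρ(t,q)` with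
`M` yields such a heavy string therefore has mean at most `ε²` (`sum_heavyProb_le`), and Markov's
inequality (`one_sub_le_sampleProb`) gives `x(t,q) < ε^(2β)` except with probability
`ε^(2-2β) ≤ εhat^(1-2β)`; for `ε ≥ 1` nothing is claimed.

Suppose `x = x(t,q) < ε^(2β)`, and let `J` be the set of light strings. Projecting `ρ(t,q)` onto the
span of the basis vectors `μ_b` with `b ∈ J` and normalizing gives a state `σ` at trace distance at
most `2 √x ≤ 2 ε^β` (`traceNorm_projected_sub_le`). Since `σ ≤ 1` is supported on that span,
`⟨ν_j|σ|ν_j⟩` is at most the squared norm of the projection of `ν_j`, that is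
`∑_{b ∈ J} |⟨μ_b|ν_j⟩|² ≤ |J| c^n`. So `σ` has min-entropy at least `-n log c - log |J|` with respect
to `N` (`le_smoothMinEntropyPM`), and `|J| ≤ 2^(n H(w_a(q) + δ))` as a Hamming ball
(`card_hamming_ball_le`).
-/

noncomputable section

open scoped ComplexOrder

namespace QuantumSampling

/-! ### Sampling without replacement -/

section Sampling

open MeasureTheory ProbabilityTheory in
/-- Hoeffding's lemma for a Bernoulli variable. -/
lemma bernoulli_mgf_le {p : ℝ} (hp0 : 0 ≤ p) (hp1 : p ≤ 1) (s : ℝ) :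
    p * Real.exp s + (1 - p) ≤ Real.exp (p * s + s ^ 2 / 8) := by
  let μ : Measure ℝ := ENNReal.ofReal p • Measure.dirac 1 + ENNReal.ofReal (1 - p) • Measure.dirac 0
  have hμ : IsProbabilityMeasure μ := ⟨by
    simp only [μ, Measure.coe_add, Measure.coe_smul, Pi.add_apply, Pi.smul_apply, smul_eq_mul,
      measure_univ, mul_one]
    rw [← ENNReal.ofReal_add hp0 (by linarith)]; simp⟩
  have hint : ∀ f : ℝ → ℝ, ∫ x, f x ∂μ = p * f 1 + (1 - p) * f 0 := by
    intro f
    have hd : ∀ (a q : ℝ), Integrable f (ENNReal.ofReal q • Measure.dirac a) := fun a q =>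
      (integrable_dirac (by simp)).smul_measure ENNReal.ofReal_ne_top
    rw [integral_add_measure (hd _ _) (hd _ _), integral_smul_measure, integral_smul_measure,
      integral_dirac, integral_dirac, ENNReal.toReal_ofReal hp0,
      ENNReal.toReal_ofReal (by linarith)]
    simp
  have hb : ∀ᵐ x ∂μ, x ∈ Set.Icc (0 : ℝ) 1 := by
    rw [ae_iff]
    simp [μ, Measure.dirac_apply]
  have h := (hasSubgaussianMGF_of_mem_Icc (X := fun x : ℝ => x) aemeasurable_id hb).mgf_le s
  rw [mgf, hint, hint] at h
  have e : p * Real.exp s + (1 - p) = Real.exp (p * s) *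
      (p * Real.exp (s * (1 - p)) + (1 - p) * Real.exp (s * (0 - p))) := by
    rw [mul_add, mul_left_comm, mul_left_comm (Real.exp (p * s)) (1 - p), ← Real.exp_add,
      ← Real.exp_add]
    ring_nf
    simp
    ring
  rw [e, Real.exp_add]
  refine mul_le_mul_of_nonneg_left ?_ (Real.exp_pos _).le
  refine le_trans (by simpa using h) (Real.exp_le_exp.2 (le_of_eq ?_))
  norm_num
  ring

variable {ι : Type*}

/-- Drawing `m + 1` elements amounts to drawing one element and then `m` of the remaining ones,
with each set counted once for each of its elements. -/
lemma sum_powersetCard_succ [DecidableEq ι] (S : Finset ι) (m : ℕ) (f : Finset ι → ℝ) :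
    ((m : ℝ) + 1) * ∑ t ∈ S.powersetCard (m + 1), f t
      = ∑ x ∈ S, ∑ t ∈ (S.erase x).powersetCard m, f (insert x t) := by
  have h1 : ((m : ℝ) + 1) * ∑ t ∈ S.powersetCard (m + 1), f t
      = ∑ t ∈ S.powersetCard (m + 1), ∑ x ∈ t, f t := by
    rw [Finset.mul_sum]
    refine Finset.sum_congr rfl fun t ht => ?_
    rw [Finset.sum_const, (Finset.mem_powersetCard.1 ht).2, nsmul_eq_mul]
    push_cast; rfl
  rw [h1, Finset.sum_sigma', Finset.sum_sigma']
  refine Finset.sum_bij' (fun p _ => ⟨p.2, p.1.erase p.2⟩) (fun p _ => ⟨insert p.1 p.2, p.1⟩)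
    ?_ ?_ ?_ ?_ ?_
  · rintro ⟨t, x⟩ h
    simp only [Finset.mem_sigma, Finset.mem_powersetCard] at h ⊢
    refine ⟨h.1.1 h.2, Finset.erase_subset_erase _ h.1.1, ?_⟩
    rw [Finset.card_erase_of_mem h.2, h.1.2]; rfl
  · rintro ⟨x, t⟩ h
    simp only [Finset.mem_sigma, Finset.mem_powersetCard] at h ⊢
    have hx : x ∉ t := fun hx => by simpa using h.2.1 hx
    refine ⟨⟨Finset.insert_subset h.1 (h.2.1.trans (Finset.erase_subset _ _)), ?_⟩,
      Finset.mem_insert_self _ _⟩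
    rw [Finset.card_insert_of_notMem hx, h.2.2]
  · rintro ⟨t, x⟩ h
    simp only [Finset.mem_sigma] at h
    simp [Finset.insert_erase h.2]
  · rintro ⟨x, t⟩ h
    simp only [Finset.mem_sigma, Finset.mem_powersetCard] at h
    have hx : x ∉ t := fun hx => by simpa using h.2.1 hx
    simp [Finset.erase_insert hx]
  · rintro ⟨t, x⟩ h
    simp only [Finset.mem_sigma] at h
    simp [Finset.insert_erase h.2]

/-- The variance proxies `m (n + 1) / (m + n)` dominate the increments of the induction below. -/
lemma variance_proxy_step (m n : ℕ) :
    (m : ℝ) * (n + 1) / (m + n) + (1 - (m : ℝ) / (m + n)) ^ 2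
      ≤ ((m : ℝ) + 1) * (n + 1) / (m + 1 + n) := by
  rcases Nat.eq_zero_or_pos (m + n) with h | h
  · obtain ⟨rfl, rfl⟩ : m = 0 ∧ n = 0 := by omega
    norm_num
  · have hp : (0 : ℝ) < m + n := by exact_mod_cast h
    have hm : (0 : ℝ) ≤ m := m.cast_nonneg
    have hn : (0 : ℝ) ≤ n := n.cast_nonneg
    have h1 : ((m : ℝ) + 1) * (n + 1) / (m + 1 + n)
        - ((m : ℝ) * (n + 1) / (m + n) + (1 - (m : ℝ) / (m + n)) ^ 2)
        = m * n / ((m + n) ^ 2 * (m + 1 + n)) := by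
      have : (m : ℝ) + 1 + n ≠ 0 := by positivity
      field_simp
      ring
    have h2 : 0 ≤ (m : ℝ) * n / ((m + n) ^ 2 * (m + 1 + n)) := by positivity
    linarith

/-- Serfling's bound on the moment generating function of the number of marked elements in a
random `m`-subset of `m + n` elements. Conditioned on the first draw, the expected number of
marked elements is a Bernoulli variable of step `n / (m + n - 1)`. -/
lemma sum_exp_card_filter_le [DecidableEq ι] (A : ι → Prop) [DecidablePred A] (l : ℝ) (n m : ℕ) (S : Finset ι)
    (hS : S.card = m + n) :
    ∑ t ∈ S.powersetCard m, Real.exp (l * (t.filter A).card) ≤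
      ((m + n).choose m : ℝ) * Real.exp (l * (m * (S.filter A).card / (m + n)) +
        l ^ 2 / 8 * (m * (n + 1) / (m + n))) := by
  induction m generalizing S with
  | zero => simp
  | succ m ih =>
    set K : ℝ := ((S.filter A).card : ℝ) with hK
    set v : ℝ := (m : ℝ) * (n + 1) / (m + n) with hv
    set u : ℝ := (m : ℝ) / (m + n) with hu
    have hN : (0 : ℝ) < m + 1 + n := by positivity
    have hKS : K + ((S.filter fun x => ¬ A x).card : ℝ) = m + 1 + n := by
      rw [hK]; exact_mod_cast (Finset.card_filter_add_card_filter_not A).trans hS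
    have hKnn : 0 ≤ K := by positivity
    have hKle : K ≤ m + 1 + n := by
      have : (0 : ℝ) ≤ ((S.filter fun x => ¬ A x).card : ℝ) := by positivity
      linarith
    have inner : ∀ x ∈ S, ∑ t ∈ (S.erase x).powersetCard m,
          Real.exp (l * ((insert x t).filter A).card) ≤
        ((m + n).choose m : ℝ) * (Real.exp (l * (u * K) + l ^ 2 / 8 * v) *
          (if A x then Real.exp (l * (1 - u)) else 1)) := by
      intro x hx
      have hcard : (S.erase x).card = m + n := by
        rw [Finset.card_erase_of_mem hx, hS]; omega
      have hins : ∀ t ∈ (S.erase x).powersetCard m,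
          Real.exp (l * ((insert x t).filter A).card)
            = (if A x then Real.exp l else 1) * Real.exp (l * (t.filter A).card) := by
        intro t ht
        have hxt : x ∉ t := fun h => by simpa using (Finset.mem_powersetCard.1 ht).1 h
        rw [Finset.filter_insert]
        split_ifs with hA
        · rw [Finset.card_insert_of_notMem (by simp [hxt]), ← Real.exp_add]
          push_cast; ring_nf
        · simp
      rw [Finset.sum_congr rfl hins, ← Finset.mul_sum]
      refine (mul_le_mul_of_nonneg_left (ih _ hcard) (by split_ifs <;> positivity)).trans
        (le_of_eq ?_)
      rw [mul_left_comm]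
      congr 1
      rw [Finset.filter_erase]
      split_ifs with hA
      · rw [Finset.card_erase_of_mem (by simp [hx, hA]), Nat.cast_pred
          (Finset.card_pos.2 ⟨x, by simp [hx, hA]⟩), ← hK, ← Real.exp_add, ← Real.exp_add, hv, hu]
        ring_nf
      · rw [Finset.erase_eq_of_notMem (by simp [hA]), ← hK, hu, hv]
        ring_nf
    have hsum := Finset.sum_le_sum inner
    rw [← sum_powersetCard_succ S m fun t => Real.exp (l * (t.filter A).card), ← Finset.mul_sum, ← Finset.mul_sum, Finset.sum_ite,
      Finset.sum_const, Finset.sum_const, nsmul_eq_mul, nsmul_eq_mul, ← hK, mul_one] at hsum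
    have hbern := bernoulli_mgf_le (p := K / (m + 1 + n)) (by positivity)
      ((div_le_one hN).2 hKle) (l * (1 - u))
    have hrew : K * Real.exp (l * (1 - u)) + ((S.filter fun x => ¬ A x).card : ℝ)
        = (m + 1 + n) * (K / (m + 1 + n) * Real.exp (l * (1 - u)) + (1 - K / (m + 1 + n))) := by
      rw [← sub_eq_iff_eq_add'.2 hKS.symm]; field_simp
    rw [hrew] at hsum
    have hchoose : ((m : ℝ) + 1) * ((m + 1 + n).choose (m + 1) : ℝ)
        = (m + 1 + n) * ((m + n).choose m : ℝ) := by
      have := Nat.add_one_mul_choose_eq (m + n) m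
      rw [show m + 1 + n = m + n + 1 by ring]
      have h' : ((m + n + 1 : ℕ) : ℝ) * ((m + n).choose m : ℝ)
        = ((m + n + 1).choose (m + 1) : ℝ) * ((m + 1 : ℕ) : ℝ) := by exact_mod_cast this
      push_cast at h'
      linarith
    have hexp : Real.exp (l * (u * K) + l ^ 2 / 8 * v) *
          Real.exp (K / (m + 1 + n) * (l * (1 - u)) + (l * (1 - u)) ^ 2 / 8)
        ≤ Real.exp (l * (((m + 1 : ℕ) : ℝ) * K / (((m + 1 : ℕ) : ℝ) + n)) +
        l ^ 2 / 8 * (((m + 1 : ℕ) : ℝ) * (n + 1) / (((m + 1 : ℕ) : ℝ) + n))) := by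
      rw [← Real.exp_add]
      apply Real.exp_le_exp.2
      push_cast
      have hlin : u * K + K / (m + 1 + n) * (1 - u) = (m + 1) * K / (m + 1 + n) := by
        have hum : u * (m + n) = m := by
          rcases Nat.eq_zero_or_pos (m + n) with h | h
          · obtain ⟨rfl, rfl⟩ : m = 0 ∧ n = 0 := by omega
            simp
          · have hp : (0 : ℝ) < m + n := by exact_mod_cast h
            rw [hu]; field_simp
        field_simp
        linear_combination K * hum
      have hvar := mul_le_mul_of_nonneg_left (variance_proxy_step m n)
        (show 0 ≤ l ^ 2 / 8 by positivity)
      rw [← hv, ← hu] at hvar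
      rw [← hlin]
      nlinarith [hvar]
    have hm1 : (0 : ℝ) < (m : ℝ) + 1 := by positivity
    refine le_of_mul_le_mul_left ?_ hm1
    refine hsum.trans ?_
    rw [← mul_assoc ((m : ℝ) + 1), hchoose]
    calc _ = (m + 1 + n) * ((m + n).choose m : ℝ) * (Real.exp (l * (u * K) + l ^ 2 / 8 * v) *
          (K / (m + 1 + n) * Real.exp (l * (1 - u)) + (1 - K / (m + 1 + n)))) := by ring
      _ ≤ _ := by
        refine mul_le_mul_of_nonneg_left (le_trans ?_ hexp) (by positivity)
        exact mul_le_mul_of_nonneg_left hbern (Real.exp_pos _).le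

lemma relWeight_mem (a : Fin 2) (j : ι → Fin 2) (t : Finset ι) :
    relWeight a (fun i : {i // i ∈ t} => j i) = ((t.filter fun i => j i ≠ a).card : ℝ) / t.card := by
  unfold relWeight
  congr 2
  · rw [← Finset.card_map (Function.Embedding.subtype _)]
    congr 1
    ext i
    simp [and_comm]
  · simp

lemma relWeight_notMem [Fintype ι] [DecidableEq ι] (a : Fin 2) (j : ι → Fin 2) (t : Finset ι) :
    relWeight a (fun i : {i // i ∉ t} => j i) =
      (((Finset.univ.filter fun i => j i ≠ a).card : ℝ) - ((t.filter fun i => j i ≠ a).card : ℝ)) /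
        (Fintype.card ι - t.card) := by
  unfold relWeight
  congr 1
  · rw [eq_sub_iff_add_eq, ← Finset.card_map (Function.Embedding.subtype _)]
    have : (Finset.univ.filter fun i => j i ≠ a) =
        (Finset.map (Function.Embedding.subtype _)
          (Finset.univ.filter fun i : {i // i ∉ t} => j i ≠ a)) ∪ (t.filter fun i => j i ≠ a) := by
      ext i
      by_cases h : i ∈ t <;> simp [h]
    rw [this, Finset.card_union_of_disjoint]
    · push_cast; rfl
    · rw [Finset.disjoint_left]
      intro i
      simp
      tauto
  · rw [Fintype.card_subtype_compl, Nat.cast_sub (Fintype.card_subtype_le _)]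
    simp

/-- The exponent of Serfling's tail bound at the accuracy `δ` is at least `log (2 / ε²)`, because
`2 n² (m + n + 2) ≥ (m + n)² (n + 1)` for `m ≤ n`. -/
lemma log_le_samplingDelta {m n : ℕ} (hm : 1 ≤ m) (hmn : m ≤ n) {ε : ℝ} (hε : 0 < ε)
    (hε1 : ε ≤ 1) :
    Real.log (2 / ε ^ 2) ≤
      2 * samplingDelta m n ε ^ 2 * n ^ 2 * m / ((n + 1) * (m + n)) := by
  have hL : 0 ≤ Real.log (2 / ε ^ 2) := by
    apply Real.log_nonneg
    rw [le_div_iff₀ (by positivity)]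
    nlinarith
  set L := Real.log (2 / ε ^ 2)
  have hm' : (1 : ℝ) ≤ m := by exact_mod_cast hm
  have hmn' : (m : ℝ) ≤ n := by exact_mod_cast hmn
  have hmp : (0 : ℝ) < m := by linarith
  have hnp : (0 : ℝ) < n := by linarith
  rw [samplingDelta, Real.sq_sqrt (by positivity)]
  rw [show 2 * (((m : ℝ) + n + 2) * L / (m * (m + n))) * n ^ 2 * m / ((n + 1) * (m + n))
    = L * (2 * n ^ 2 * (m + n + 2) / ((n + 1) * (m + n) ^ 2)) by field_simp]
  refine le_mul_of_one_le_right hL ?_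
  rw [one_le_div (by positivity)]
  nlinarith [mul_nonneg (sub_nonneg.2 hmn') (mul_nonneg hmp.le hnp.le),
    mul_nonneg (sub_nonneg.2 hmn') hmp.le, mul_nonneg (sub_nonneg.2 hmn') hnp.le,
    mul_nonneg (mul_nonneg (sub_nonneg.2 hmn') hnp.le) hnp.le]

/-- For a fixed string, a random sample of `m` positions underestimates the relative weight of the
other positions by more than `δ` with probability at most `ε²`. -/
lemma card_bad_samples_le [Fintype ι] [DecidableEq ι] {m n : ℕ} (hι : Fintype.card ι = m + n) (hm : 1 ≤ m)
    (hmn : m ≤ n) {ε : ℝ} (hε : 0 < ε) (hε1 : ε ≤ 1) (a : Fin 2) (j : ι → Fin 2) :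
    ∑ t ∈ Finset.powersetCard m (Finset.univ : Finset ι),
      (if relWeight a (fun i : {i // i ∈ t} => j i) + samplingDelta m n ε <
        relWeight a (fun i : {i // i ∉ t} => j i) then (1 : ℝ) else 0)
      ≤ ((m + n).choose m : ℝ) * ε ^ 2 := by
  set δ := samplingDelta m n ε with hδ
  have hδ0 : 0 ≤ δ := Real.sqrt_nonneg _
  set K : ℝ := ((Finset.univ.filter fun i => j i ≠ a).card : ℝ) with hK
  have hm' : (1 : ℝ) ≤ m := by exact_mod_cast hm
  have hmn' : (m : ℝ) ≤ n := by exact_mod_cast hmn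
  have hmp : (0 : ℝ) < m := by linarith
  have hnp : (0 : ℝ) < n := by linarith
  -- the minimiser of the Chernoff bound
  set θ : ℝ := 4 * δ * n / (n + 1) with hθ
  have hθ0 : 0 ≤ θ := by positivity
  have hmgf := sum_exp_card_filter_le (fun i => j i ≠ a) (-θ) n m Finset.univ
    (by rw [Finset.card_univ, hι])
  have hle : ∀ t ∈ Finset.powersetCard m (Finset.univ : Finset ι),
      (if relWeight a (fun i : {i // i ∈ t} => j i) + δ <
        relWeight a (fun i : {i // i ∉ t} => j i) then (1 : ℝ) else 0) ≤
      Real.exp (θ * ((m * K - δ * m * n) / (m + n))) *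
        Real.exp (-θ * (t.filter fun i => j i ≠ a).card) := by
    intro t ht
    split_ifs with h
    · rw [relWeight_mem, relWeight_notMem, (Finset.mem_powersetCard.1 ht).2, hι, ← hK] at h
      set k : ℝ := ((t.filter fun i => j i ≠ a).card : ℝ)
      rw [← Real.exp_add]
      apply Real.one_le_exp
      have h2 : k ≤ (m * K - δ * m * n) / (m + n) := by
        rw [le_div_iff₀ (by positivity)]
        push_cast at h
        rw [add_sub_cancel_left, lt_div_iff₀ hnp] at h
        have h3 : (k / m + δ) * n * m < (K - k) * m := mul_lt_mul_of_pos_right h hmp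
        rw [show (k / m + δ) * n * m = k * n + δ * m * n by field_simp] at h3
        linarith
      nlinarith
    · positivity
  refine (Finset.sum_le_sum hle).trans ?_
  rw [← Finset.mul_sum]
  refine (mul_le_mul_of_nonneg_left hmgf (Real.exp_pos _).le).trans ?_
  rw [mul_left_comm, ← Real.exp_add]
  refine mul_le_mul_of_nonneg_left ?_ (by positivity)
  have hlog := log_le_samplingDelta hm hmn hε hε1
  rw [← hδ] at hlog
  have he : θ * ((m * K - δ * m * n) / (m + n)) + (-θ * (m * K / (m + n)) +
      (-θ) ^ 2 / 8 * (m * (n + 1) / (m + n)))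
      = -(2 * δ ^ 2 * n ^ 2 * m / ((n + 1) * (m + n))) := by
    rw [hθ]; field_simp; ring
  rw [← hK, he]
  calc _ ≤ Real.exp (-Real.log (2 / ε ^ 2)) := Real.exp_le_exp.2 (by linarith)
    _ = ε ^ 2 / 2 := by rw [Real.exp_neg, Real.exp_log (by positivity), inv_div]
    _ ≤ ε ^ 2 := by linarith [sq_nonneg ε]

end Sampling

/-! ### Hamming balls -/

/-- A Hamming ball of relative radius `w` has at most `2 ^ (n H(w))` points, where `w ≥ 0`. -/
lemma card_hamming_ball_le {κ : Type*} [Fintype κ] [DecidableEq κ] (a : Fin 2) {w : ℝ}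
    (hw : 0 ≤ w) :
    ((Finset.univ.filter fun b : κ → Fin 2 => relWeight a b ≤ w).card : ℝ) ≤
      2 ^ ((Fintype.card κ : ℝ) * extBinEntropy w) := by
  set n := Fintype.card κ with hn
  rw [extBinEntropy, if_neg hw.not_gt]
  split_ifs with hw2
  · rcases Nat.eq_zero_or_pos n with hn0 | hn0
    · refine le_trans (Nat.cast_le.2 (Finset.card_filter_le _ _)) ?_
      simp [← hn, hn0]
    have hnp : (0 : ℝ) < n := by exact_mod_cast hn0
    rcases hw.eq_or_lt with rfl | hw0
    · have : (Finset.univ.filter fun b : κ → Fin 2 => relWeight a b ≤ 0) ⊆ {fun _ => a} := by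
        intro b hb
        rw [Finset.mem_filter, relWeight, div_le_iff₀ (by exact_mod_cast hn0), zero_mul] at hb
        have h0 : (Finset.univ.filter fun i => b i ≠ a).card = 0 := by
          exact_mod_cast le_antisymm hb.2 (Nat.cast_nonneg _)
        rw [Finset.card_eq_zero, Finset.filter_eq_empty_iff] at h0
        rw [Finset.mem_singleton]
        ext1 i
        simpa using h0 (Finset.mem_univ i)
      refine (Nat.cast_le.2 (Finset.card_le_card this)).trans ?_
      simp
    have hw1 : 0 < 1 - w := by linarith
    -- the weights of the i.i.d. distribution that leaves `a` with probability `w`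
    have htot : ∑ b : κ → Fin 2, ∏ i, (if b i ≠ a then w else 1 - w) = 1 := by
      have h := Finset.prod_univ_sum (fun _ : κ => (Finset.univ : Finset (Fin 2)))
        (fun _ x => if x ≠ a then w else 1 - w)
      rw [Fintype.piFinset_univ] at h
      rw [← h]
      refine Finset.prod_eq_one fun i _ => ?_
      rw [Fin.sum_univ_two]
      fin_cases a <;> simp
    have hlow : ∀ b ∈ Finset.univ.filter fun b : κ → Fin 2 => relWeight a b ≤ w,
        Real.exp (-(n * Real.binEntropy w)) ≤ ∏ i, (if b i ≠ a then w else 1 - w) := by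
      intro b hb
      rw [Finset.mem_filter, relWeight, div_le_iff₀ (by exact_mod_cast hn0), ← hn] at hb
      set k := (Finset.univ.filter fun i => b i ≠ a).card with hk
      have hkn : ((Finset.univ.filter fun i => ¬ b i ≠ a).card : ℝ) = n - k := by
        rw [eq_sub_iff_add_eq']
        exact_mod_cast Finset.card_filter_add_card_filter_not (s := Finset.univ)
          (fun i => b i ≠ a)
      rw [Finset.prod_ite, Finset.prod_const, Finset.prod_const, ← hk, ← Real.rpow_natCast,
        ← Real.rpow_natCast, hkn, Real.rpow_def_of_pos hw0, Real.rpow_def_of_pos hw1,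
        ← Real.exp_add]
      apply Real.exp_le_exp.2
      have hll : Real.log w ≤ Real.log (1 - w) := Real.log_le_log hw0 (by linarith)
      rw [Real.binEntropy, Real.log_inv, Real.log_inv]
      nlinarith [mul_nonneg (sub_nonneg.2 hb.2) (sub_nonneg.2 hll)]
    have hsum := Finset.sum_le_sum hlow
    rw [Finset.sum_const, nsmul_eq_mul] at hsum
    have hle1 := hsum.trans ((Finset.sum_le_sum_of_subset_of_nonneg (Finset.subset_univ _)
      fun b _ _ => Finset.prod_nonneg fun i _ => by split_ifs <;> linarith).trans htot.le)
    rw [Real.rpow_def_of_pos (by norm_num), show Real.log 2 * (n * (Real.binEntropy w / Real.log 2))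
      = n * Real.binEntropy w by have := Real.log_pos (one_lt_two (α := ℝ)); field_simp]
    rw [Real.exp_neg] at hle1
    rwa [mul_inv_le_iff₀ (Real.exp_pos _), one_mul] at hle1
  · refine le_trans (Nat.cast_le.2 (Finset.card_filter_le _ _)) ?_
    simp [← hn]

open Matrix

/-! ### The trace norm -/

section TraceNorm

variable {I : Type*} [Fintype I]

lemma re_trace_conjTranspose_mul_self (X : Matrix I I ℂ) :
    (Xᴴ * X).trace.re = ∑ i, ∑ j, ‖X j i‖ ^ 2 := by
  simp only [trace, diag_apply, mul_apply, conjTranspose_apply, Complex.re_sum]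
  refine Finset.sum_congr rfl fun i _ => Finset.sum_congr rfl fun j _ => ?_
  rw [Complex.star_def, ← Complex.normSq_eq_conj_mul_self, Complex.ofReal_re,
    Complex.normSq_eq_norm_sq]

/-- Cauchy-Schwarz for the Hilbert-Schmidt inner product. -/
lemma re_trace_conjTranspose_mul_le (Y X : Matrix I I ℂ) :
    (Yᴴ * X).trace.re ≤ √(Yᴴ * Y).trace.re * √(Xᴴ * X).trace.re := by
  simp only [re_trace_conjTranspose_mul_self, ← Finset.sum_product']
  refine le_trans ?_ (Real.sum_mul_le_sqrt_mul_sqrt _ (fun p : I × I => ‖Y p.2 p.1‖)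
    (fun p => ‖X p.2 p.1‖))
  simp only [trace, diag_apply, mul_apply, conjTranspose_apply, Complex.re_sum,
    Finset.sum_product]
  refine Finset.sum_le_sum fun i _ => Finset.sum_le_sum fun j _ => ?_
  refine (Complex.re_le_norm _).trans ?_
  simp

/-- Polar decomposition: `tr |A| = tr (U A)` for a contraction `U`. -/
lemma exists_contraction_sum_sqrt_eigenvalues [DecidableEq I] (A : Matrix I I ℂ) :
    ∃ U : Matrix I I ℂ, (1 - U * Uᴴ).PosSemidef ∧
      ∑ i, √((isHermitian_conjTranspose_mul_self A).eigenvalues i) = (U * A).trace.re := by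
  set h := isHermitian_conjTranspose_mul_self A
  set V : Matrix I I ℂ := (h.eigenvectorUnitary : Matrix I I ℂ)
  have hVV : Vᴴ * V = 1 := by
    simpa [star_eq_conjTranspose] using Unitary.coe_star_mul_self h.eigenvectorUnitary
  have hVV' : V * Vᴴ = 1 := by
    simpa [star_eq_conjTranspose] using Unitary.coe_mul_star_self h.eigenvectorUnitary
  have hnn : ∀ i, 0 ≤ h.eigenvalues i := eigenvalues_conjTranspose_mul_self_nonneg A
  have hspec : Aᴴ * A = V * diagonal (fun i => (h.eigenvalues i : ℂ)) * Vᴴ := by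
    have := h.spectral_theorem
    rw [Unitary.conjStarAlgAut_apply] at this
    simpa [star_eq_conjTranspose, Function.comp_def] using this
  -- the pseudo-inverse of `|A|`; zero singular values have the inverse `0`
  set D : Matrix I I ℂ := diagonal fun i => (((√(h.eigenvalues i))⁻¹ : ℝ) : ℂ) with hD
  have hDH : Dᴴ = D := by
    rw [hD, diagonal_conjTranspose]; congr 1; ext i; simp
  have key : Vᴴ * (Aᴴ * A) * V = diagonal (fun i => (h.eigenvalues i : ℂ)) := by
    calc _ = Vᴴ * (V * diagonal (fun i => (h.eigenvalues i : ℂ)) * Vᴴ) * V :=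
            congrArg (fun X => Vᴴ * X * V) hspec
      _ = (Vᴴ * V) * diagonal (fun i => (h.eigenvalues i : ℂ)) * (Vᴴ * V) := by
            simp only [Matrix.mul_assoc]
      _ = _ := by rw [hVV]; simp
  refine ⟨V * D * Vᴴ * Aᴴ, ?_, ?_⟩
  · have h1 : 1 - (V * D * Vᴴ * Aᴴ) * (V * D * Vᴴ * Aᴴ)ᴴ
        = V * (1 - D * (Vᴴ * (Aᴴ * A) * V) * D) * Vᴴ := by
      simp only [conjTranspose_mul, conjTranspose_conjTranspose, hDH, Matrix.mul_sub,
        Matrix.sub_mul, Matrix.mul_one, hVV', Matrix.mul_assoc]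
    rw [h1, key]
    refine PosSemidef.mul_mul_conjTranspose_same ?_ V
    rw [hD, diagonal_mul_diagonal, diagonal_mul_diagonal, ← diagonal_one, diagonal_sub]
    refine PosSemidef.diagonal fun i => ?_
    have : (√(h.eigenvalues i))⁻¹ * h.eigenvalues i * (√(h.eigenvalues i))⁻¹ ≤ 1 := by
      rcases (hnn i).eq_or_lt with h0 | h0
      · simp [← h0]
      · have hs := Real.sqrt_pos.2 h0
        have h2 := Real.mul_self_sqrt (hnn i)
        apply le_of_eq
        field_simp
        nlinarith
    simp only [Pi.zero_apply]
    rw [← Complex.ofReal_mul, ← Complex.ofReal_mul, ← Complex.ofReal_one, ← Complex.ofReal_sub]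
    exact Complex.zero_le_real.2 (by linarith)
  · have h1 : (V * D * Vᴴ * Aᴴ * A).trace = (D * (Vᴴ * (Aᴴ * A) * V)).trace := by
      rw [show V * D * Vᴴ * Aᴴ * A = V * (D * (Vᴴ * (Aᴴ * A))) by simp only [Matrix.mul_assoc],
        trace_mul_comm]
      simp only [Matrix.mul_assoc]
    rw [h1, key, hD, diagonal_mul_diagonal, trace_diagonal, Complex.re_sum]
    refine Finset.sum_congr rfl fun i _ => ?_
    rw [← Complex.ofReal_mul, Complex.ofReal_re]
    rcases (hnn i).eq_or_lt with h0 | h0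
    · simp [← h0]
    · have hs := Real.sqrt_pos.2 h0
      have h2 := Real.mul_self_sqrt (hnn i)
      field_simp
      nlinarith

lemma re_trace_contraction_mul_mul_conjTranspose_le [DecidableEq I] {U : Matrix I I ℂ}
    (hU : (1 - U * Uᴴ).PosSemidef) (X Y : Matrix I I ℂ) :
    (U * (X * Yᴴ)).trace.re ≤ √(Yᴴ * Y).trace.re * √(Xᴴ * X).trace.re := by
  have h1 : (U * (X * Yᴴ)).trace = ((Uᴴ * Y)ᴴ * X).trace := by
    rw [conjTranspose_mul, conjTranspose_conjTranspose, ← Matrix.mul_assoc, trace_mul_comm,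
      Matrix.mul_assoc]
  rw [h1]
  refine (re_trace_conjTranspose_mul_le _ _).trans
    (mul_le_mul_of_nonneg_right (Real.sqrt_le_sqrt ?_) (Real.sqrt_nonneg _))
  have h2 := (hU.conjTranspose_mul_mul_same Y).trace_nonneg
  have h3 : Yᴴ * (1 - U * Uᴴ) * Y = Yᴴ * Y - (Uᴴ * Y)ᴴ * (Uᴴ * Y) := by
    simp only [conjTranspose_mul, conjTranspose_conjTranspose, Matrix.mul_sub, Matrix.sub_mul,
      Matrix.mul_one, Matrix.mul_assoc]
  rw [h3, trace_sub] at h2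
  have h4 := (Complex.le_def.1 h2).1
  simp only [Complex.zero_re, Complex.sub_re] at h4
  linarith

lemma exists_eq_mul_conjTranspose [DecidableEq I] {ρ : Matrix I I ℂ} (hρ : ρ.PosSemidef) :
    ∃ B : Matrix I I ℂ, ρ = B * Bᴴ := by
  have h := hρ.1
  refine ⟨h.eigenvectorUnitary * diagonal fun i => ((√(h.eigenvalues i) : ℝ) : ℂ), ?_⟩
  have hd : (diagonal fun i => ((√(h.eigenvalues i) : ℝ) : ℂ)) *
      (diagonal fun i => ((√(h.eigenvalues i) : ℝ) : ℂ))ᴴ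
        = diagonal (RCLike.ofReal ∘ h.eigenvalues) := by
    rw [diagonal_conjTranspose, diagonal_mul_diagonal]
    congr 1
    ext i
    simp only [Function.comp_apply, Pi.star_apply, Complex.star_def, Complex.conj_ofReal]
    rw [← Complex.ofReal_mul, Real.mul_self_sqrt (hρ.eigenvalues_nonneg i)]
    rfl
  have hs := h.spectral_theorem
  rw [Unitary.conjStarAlgAut_apply, ← hd, star_eq_conjTranspose] at hs
  refine hs.trans ?_
  rw [conjTranspose_mul]
  simp only [Matrix.mul_assoc]

end TraceNorm

variable {κ : Type*} [Fintype κ] [DecidableEq κ]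

/-- Gentle measurement: projecting a state onto the range of a projection `Q` of probability `s`
moves it by at most `2 √(1 - s)` in trace norm. Writing the two states as `C Cᴴ` and `B Bᴴ` amounts
to purifying them; the claim is then Cauchy-Schwarz applied to
`2 (C Cᴴ - B Bᴴ) = (C - B) (C + B)ᴴ + (C + B) (C - B)ᴴ`. -/
lemma traceNorm_projected_sub_le {ρ Q : QubitOp κ} (hρ : IsDensity ρ) (hQ : Qᴴ = Q)
    (hQQ : Q * Q = Q) {s : ℝ} (hs : 0 < s) (hsQ : (Q * ρ).trace = (s : ℂ)) :
    traceNorm ((s : ℂ)⁻¹ • (Q * ρ * Q) - ρ) ≤ 2 * √(1 - s) := by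
  obtain ⟨B, hB⟩ := exists_eq_mul_conjTranspose hρ.1
  have hr := Real.sqrt_pos.2 hs
  have hrr := Real.mul_self_sqrt hs.le
  set r := √s with hr_def
  set C : QubitOp κ := (r : ℂ)⁻¹ • (Q * B) with hC
  have hrC : (r : ℂ) ≠ 0 := by exact_mod_cast hr.ne'
  have hCH : Cᴴ = (r : ℂ)⁻¹ • (Bᴴ * Q) := by
    simp [hC, conjTranspose_smul, conjTranspose_mul, hQ]
  have hsr : (s : ℂ) = r * r := by exact_mod_cast hrr.symm
  have hCC : C * Cᴴ = (s : ℂ)⁻¹ • (Q * ρ * Q) := by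
    rw [hCH, hC, hB, smul_mul_smul_comm, hsr, mul_inv]
    simp only [Matrix.mul_assoc]
  have tBB : (Bᴴ * B).trace = 1 := by rw [trace_mul_comm, ← hB, hρ.2]
  have tQ : (Bᴴ * (Q * B)).trace = s := by
    rw [trace_mul_comm, Matrix.mul_assoc, ← hB, hsQ]
  have tBC : (Bᴴ * C).trace = r := by
    rw [hC, mul_smul_comm, trace_smul, tQ, hsr, smul_eq_mul]; field_simp
  have tCB : (Cᴴ * B).trace = r := by
    rw [hCH, smul_mul_assoc, trace_smul, Matrix.mul_assoc, tQ, hsr, smul_eq_mul]; field_simp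
  have tCC : (Cᴴ * C).trace = 1 := by
    rw [hCH, hC, smul_mul_smul_comm, trace_smul, Matrix.mul_assoc, ← Matrix.mul_assoc Q, hQQ, tQ,
      hsr, smul_eq_mul]; field_simp
  have tm : ((C - B)ᴴ * (C - B)).trace.re = 2 - 2 * r := by
    simp only [conjTranspose_sub, Matrix.sub_mul, Matrix.mul_sub, trace_sub, tBB, tBC, tCB, tCC,
      Complex.sub_re, Complex.one_re, Complex.ofReal_re]; ring
  have tp : ((C + B)ᴴ * (C + B)).trace.re = 2 + 2 * r := by
    simp only [conjTranspose_add, Matrix.add_mul, Matrix.mul_add, trace_add, tBB, tBC, tCB, tCC,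
      Complex.add_re, Complex.one_re, Complex.ofReal_re]; ring
  obtain ⟨U, hU, hUA⟩ := exists_contraction_sum_sqrt_eigenvalues
    ((s : ℂ)⁻¹ • (Q * ρ * Q) - ρ)
  rw [traceNorm, hUA, ← hCC]
  have e : U * (C * Cᴴ - ρ) + U * (C * Cᴴ - ρ)
      = U * ((C - B) * (C + B)ᴴ) + U * ((C + B) * (C - B)ᴴ) := by
    rw [hB, ← Matrix.mul_add, ← Matrix.mul_add]
    congr 1
    simp only [conjTranspose_add, conjTranspose_sub, Matrix.sub_mul, Matrix.mul_sub,
      Matrix.add_mul, Matrix.mul_add]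
    abel
  have e' := congrArg (fun X => (trace X).re) e
  simp only [trace_add, Complex.add_re] at e'
  have h1 := re_trace_contraction_mul_mul_conjTranspose_le hU (C - B) (C + B)
  have h2 := re_trace_contraction_mul_mul_conjTranspose_le hU (C + B) (C - B)
  rw [tm, tp] at h1 h2
  have hr1 : 0 ≤ 2 - 2 * r := by
    rw [← tm, re_trace_conjTranspose_mul_self]; positivity
  have h3 : √(2 + 2 * r) * √(2 - 2 * r) = 2 * √(1 - s) := by
    rw [← Real.sqrt_mul (by positivity), show (2 + 2 * r) * (2 - 2 * r) = 2 ^ 2 * (1 - s) by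
      rw [← hrr]; ring, Real.sqrt_mul (by positivity), Real.sqrt_sq (by norm_num)]
  rw [mul_comm (√(2 - 2 * r))] at h2
  linarith

/-! ### Product bases -/

section ProductBasis

variable {κ : Type*} [Fintype κ]

lemma star_prodVec_dotProduct [DecidableEq κ] (M N : QubitPM) (b j : κ → Fin 2) :
    star (prodVec M b) ⬝ᵥ prodVec N j = ∏ i, inner ℂ (M (b i)) (N (j i)) := by
  simp only [EuclideanSpace.inner_eq_star_dotProduct, dotProduct, prodVec, Pi.star_apply,
    star_prod]
  rw [Finset.prod_univ_sum, Fintype.piFinset_univ]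
  refine Finset.sum_congr rfl fun x _ => ?_
  rw [← Finset.prod_mul_distrib]
  exact Finset.prod_congr rfl fun i _ => mul_comm _ _

/-- The unitary matrix whose columns are the vectors of the product basis. -/
def basisMat (N : QubitPM) : QubitOp κ := Matrix.of fun x j => prodVec N j x

variable [DecidableEq κ]

lemma conjTranspose_basisMat_mul (N : QubitPM) :
    (basisMat N : QubitOp κ)ᴴ * basisMat N = 1 := by
  ext b j
  have h : ((basisMat N : QubitOp κ)ᴴ * basisMat N : QubitOp κ) b j
      = star (prodVec N b) ⬝ᵥ prodVec N j := rfl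
  rw [h, star_prodVec_dotProduct, one_apply]
  simp only [orthonormal_iff_ite.1 N.orthonormal]
  split_ifs with hbj
  · subst hbj; simp
  · obtain ⟨i, hi⟩ := Function.ne_iff.1 hbj
    exact Finset.prod_eq_zero (Finset.mem_univ i) (by simp [hi])

lemma basisMat_mul_conjTranspose (N : QubitPM) :
    (basisMat N : QubitOp κ) * (basisMat N)ᴴ = 1 :=
  mul_eq_one_comm.1 (conjTranspose_basisMat_mul N)

lemma conj_basisMat_apply_self (N : QubitPM) (ρ : QubitOp κ) (j : κ → Fin 2) :
    ((basisMat N)ᴴ * (ρ * basisMat N) : QubitOp κ) j j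
      = star (prodVec N j) ⬝ᵥ (ρ.mulVec (prodVec N j)) := rfl

omit [DecidableEq κ] in
lemma basisMat_apply (N : QubitPM) (x j : κ → Fin 2) :
    (basisMat N : QubitOp κ) x j = prodVec N j x := rfl

lemma basisMat_mul_diagonal_mul (N : QubitPM) (d : (κ → Fin 2) → ℂ) :
    (basisMat N : QubitOp κ) * diagonal d * (basisMat N)ᴴ
      = ∑ j, d j • vecMulVec (prodVec N j) (star (prodVec N j)) := by
  ext x y
  rw [mul_apply, Matrix.sum_apply]
  refine Finset.sum_congr rfl fun j _ => ?_
  rw [mul_diagonal, Matrix.smul_apply, vecMulVec_apply, conjTranspose_apply, basisMat_apply,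
    basisMat_apply, smul_eq_mul, Pi.star_apply]
  ring

/-- The probability `⟨φ_j|ρ|φ_j⟩` of the outcome `j` when each qubit is measured with `N`. -/
def bornWeight (N : QubitPM) (ρ : QubitOp κ) (j : κ → Fin 2) : ℝ :=
  (star (prodVec N j) ⬝ᵥ (ρ.mulVec (prodVec N j))).re

lemma bornWeight_nonneg (N : QubitPM) {ρ : QubitOp κ} (hρ : ρ.PosSemidef) (j : κ → Fin 2) :
    0 ≤ bornWeight N ρ j := hρ.re_dotProduct_nonneg _

lemma ofReal_bornWeight (N : QubitPM) {ρ : QubitOp κ} (hρ : ρ.PosSemidef) (j : κ → Fin 2) :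
    (bornWeight N ρ j : ℂ) = star (prodVec N j) ⬝ᵥ (ρ.mulVec (prodVec N j)) :=
  (Complex.eq_re_of_ofReal_le (r := 0) (by simpa using hρ.dotProduct_mulVec_nonneg _)).symm

lemma sum_bornWeight (N : QubitPM) (ρ : QubitOp κ) : ∑ j, bornWeight N ρ j = ρ.trace.re := by
  have h : ρ.trace = ((basisMat N)ᴴ * (ρ * basisMat N)).trace := by
    rw [trace_mul_comm, Matrix.mul_assoc, basisMat_mul_conjTranspose, Matrix.mul_one]
  rw [h, trace, Complex.re_sum]
  rfl

lemma bornWeight_smul (N : QubitPM) (r : ℝ) (ρ : QubitOp κ) (j : κ → Fin 2) :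
    bornWeight N ((r : ℂ) • ρ) j = r * bornWeight N ρ j := by
  rw [bornWeight, smul_mulVec, dotProduct_smul, smul_eq_mul, Complex.re_ofReal_mul, bornWeight]

/-- The projection onto the span of the product basis vectors with labels in `J`. -/
def labelProj (M : QubitPM) (J : Finset (κ → Fin 2)) : QubitOp κ :=
  basisMat M * diagonal (fun j => if j ∈ J then 1 else 0) * (basisMat M)ᴴ

lemma labelProj_conjTranspose (M : QubitPM) (J : Finset (κ → Fin 2)) :
    (labelProj M J)ᴴ = labelProj M J := by
  have h : star (fun j : κ → Fin 2 => if j ∈ J then (1 : ℂ) else 0)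
      = fun j => if j ∈ J then 1 else 0 := by
    ext j; simp only [Pi.star_apply]; split_ifs <;> simp
  rw [labelProj, conjTranspose_mul, conjTranspose_mul, diagonal_conjTranspose,
    conjTranspose_conjTranspose, h, Matrix.mul_assoc]

lemma labelProj_mul_self (M : QubitPM) (J : Finset (κ → Fin 2)) :
    labelProj M J * labelProj M J = labelProj M J := by
  set W : QubitOp κ := basisMat M with hW
  set D : QubitOp κ := diagonal (fun j => if j ∈ J then 1 else 0) with hD
  have hDD : D * D = D := by rw [hD, diagonal_mul_diagonal]; congr 1; ext j; simp
  change W * D * Wᴴ * (W * D * Wᴴ) = W * D * Wᴴ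
  calc _ = W * D * (Wᴴ * W) * D * Wᴴ := by simp only [Matrix.mul_assoc]
    _ = W * (D * D) * Wᴴ := by
      rw [hW, conjTranspose_basisMat_mul, Matrix.mul_one, ← Matrix.mul_assoc]
    _ = _ := by rw [hDD]

lemma trace_labelProj_mul (M : QubitPM) (J : Finset (κ → Fin 2)) {ρ : QubitOp κ}
    (hρ : ρ.PosSemidef) :
    (labelProj M J * ρ).trace = ((∑ j ∈ J, bornWeight M ρ j : ℝ) : ℂ) := by
  rw [labelProj, Matrix.mul_assoc, Matrix.mul_assoc, trace_mul_comm, Matrix.mul_assoc, trace]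
  simp only [diag_apply, diagonal_mul, Matrix.mul_assoc, conj_basisMat_apply_self]
  rw [Complex.ofReal_sum]
  simp [ofReal_bornWeight M hρ]

/-! ### Overlaps -/

lemma norm_inner_sq_le_overlap (M N : QubitPM) (x y : Fin 2) :
    ‖inner ℂ (M x) (N y)‖ ^ 2 ≤ overlap M N :=
  Finset.le_sup' (fun p : Fin 2 × Fin 2 => ‖inner ℂ (M p.1) (N p.2)‖ ^ 2) (Finset.mem_univ (x, y))

lemma overlap_pos (M N : QubitPM) : 0 < overlap M N := by
  have h := N.sum_sq_norm_inner_left (M 0)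
  rw [M.orthonormal.1 0, Fin.sum_univ_two] at h
  linarith [norm_inner_sq_le_overlap M N 0 0, norm_inner_sq_le_overlap M N 0 1]

lemma norm_star_prodVec_dotProduct_sq_le (M N : QubitPM) (b j : κ → Fin 2) :
    ‖star (prodVec M b) ⬝ᵥ prodVec N j‖ ^ 2 ≤ overlap M N ^ Fintype.card κ := by
  rw [star_prodVec_dotProduct, norm_prod, ← Finset.prod_pow]
  exact (Finset.prod_le_prod (fun _ _ => by positivity)
    fun i _ => norm_inner_sq_le_overlap M N (b i) (j i)).trans (by simp)

/-- The projection of a vector of the product basis of `N` onto the span of the vectors of the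
product basis of `M` with labels in `J` has squared norm at most `|J| c ^ n`. -/
lemma sum_norm_labelProj_mulVec_sq_le (M N : QubitPM) (J : Finset (κ → Fin 2)) (j : κ → Fin 2) :
    ∑ x, ‖(labelProj M J).mulVec (prodVec N j) x‖ ^ 2
      ≤ J.card * overlap M N ^ Fintype.card κ := by
  set v := prodVec N j with hv
  have h1 : ((∑ x, ‖(labelProj M J).mulVec v x‖ ^ 2 : ℝ) : ℂ)
      = star v ⬝ᵥ (labelProj M J).mulVec v := by
    have : star v ⬝ᵥ (labelProj M J).mulVec v
        = star ((labelProj M J).mulVec v) ⬝ᵥ (labelProj M J).mulVec v := by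
      rw [star_mulVec, labelProj_conjTranspose, dotProduct_mulVec (vecMul _ _), vecMul_vecMul,
        labelProj_mul_self, ← dotProduct_mulVec]
    rw [this, dotProduct, Complex.ofReal_sum]
    refine Finset.sum_congr rfl fun x _ => ?_
    rw [Pi.star_apply, Complex.star_def, ← Complex.normSq_eq_conj_mul_self,
      Complex.normSq_eq_norm_sq]
  have h2 : star v ⬝ᵥ (labelProj M J).mulVec v
      = ((∑ b ∈ J, ‖star (prodVec M b) ⬝ᵥ v‖ ^ 2 : ℝ) : ℂ) := by
    rw [labelProj, basisMat_mul_diagonal_mul, sum_mulVec, dotProduct_sum, Complex.ofReal_sum,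
      ← Finset.sum_subset (Finset.subset_univ J)]
    · refine Finset.sum_congr rfl fun b hb => ?_
      rw [if_pos hb, one_smul, vecMulVec_mulVec, ← Complex.normSq_eq_norm_sq,
        Complex.normSq_eq_conj_mul_self, dotProduct_smul, ← Complex.star_def, ← star_dotProduct]
      rfl
    · intro b _ hb
      simp [hb]
  have h3 := Complex.ofReal_injective (h1.trans h2)
  rw [h3]
  refine (Finset.sum_le_sum fun b _ => norm_star_prodVec_dotProduct_sq_le M N b j).trans ?_
  simp

end ProductBasis

/-! ### Min-entropy of measured states -/

section MinEntropy

variable {κ : Type*} [Fintype κ] [DecidableEq κ]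

lemma measured_eq (N : QubitPM) {ρ : QubitOp κ} (hρ : ρ.PosSemidef) :
    measured N ρ = basisMat N * diagonal (fun j => (bornWeight N ρ j : ℂ)) * (basisMat N)ᴴ := by
  rw [basisMat_mul_diagonal_mul, measured]
  exact Finset.sum_congr rfl fun j _ => by rw [ofReal_bornWeight N hρ]

lemma minEntropyPM_exponent_le (N : QubitPM) {ρ : QubitOp κ} (hρ : IsDensity ρ) {l : ℝ}
    (hl : ((((2 : ℝ) ^ (-l) : ℝ) : ℂ) • (1 : QubitOp κ) - measured N ρ).PosSemidef) :
    l ≤ Fintype.card κ := by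
  have h := (Complex.le_def.1 hl.trace_nonneg).1
  have ht : (measured N ρ).trace = 1 := by
    rw [measured_eq N hρ.1, trace_mul_comm, ← Matrix.mul_assoc, conjTranspose_basisMat_mul,
      Matrix.one_mul, trace_diagonal, ← Complex.ofReal_sum, sum_bornWeight, hρ.2]
    simp
  rw [trace_sub, trace_smul, trace_one, ht, smul_eq_mul, Complex.sub_re, Complex.re_ofReal_mul] at h
  simp only [Complex.zero_re, Complex.one_re, Fintype.card_fun, Fintype.card_fin, Nat.cast_pow,
    Nat.cast_ofNat] at h
  rw [show ((2 : ℂ) ^ Fintype.card κ).re = (2 : ℝ) ^ ((Fintype.card κ : ℕ) : ℝ) by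
      rw [Real.rpow_natCast]; norm_cast,
    ← Real.rpow_add (by norm_num)] at h
  have h1 : (1 : ℝ) ≤ 2 ^ (-l + (Fintype.card κ : ℝ)) := by linarith
  by_contra hlt
  exact absurd (Real.rpow_lt_one_of_one_lt_of_neg one_lt_two (by linarith)) h1.not_gt

lemma minEntropyPM_le_card (N : QubitPM) {ρ : QubitOp κ} (hρ : IsDensity ρ) :
    minEntropyPM N ρ ≤ Fintype.card κ :=
  Real.sSup_le (fun _ hl => minEntropyPM_exponent_le N hρ hl) (Nat.cast_nonneg _)

lemma neg_logb_le_minEntropyPM (N : QubitPM) {ρ : QubitOp κ} (hρ : IsDensity ρ) {r : ℝ}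
    (hr : 0 < r) (h : ∀ j, bornWeight N ρ j ≤ r) : -Real.logb 2 r ≤ minEntropyPM N ρ := by
  refine le_csSup ⟨_, fun _ hl => minEntropyPM_exponent_le N hρ hl⟩ ?_
  change PosSemidef _
  rw [neg_neg, Real.rpow_logb (by norm_num) (by norm_num) hr, measured_eq N hρ.1]
  have e : (r : ℂ) • (1 : QubitOp κ)
      - basisMat N * diagonal (fun j => (bornWeight N ρ j : ℂ)) * (basisMat N)ᴴ
      = basisMat N * diagonal (fun j => ((r - bornWeight N ρ j : ℝ) : ℂ)) * (basisMat N)ᴴ := by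
    have : (diagonal (fun j => ((r - bornWeight N ρ j : ℝ) : ℂ)) : QubitOp κ)
        = (r : ℂ) • 1 - diagonal (fun j => (bornWeight N ρ j : ℂ)) := by
      rw [smul_one_eq_diagonal, diagonal_sub]
      simp
    rw [this, Matrix.mul_sub, Matrix.sub_mul, mul_smul_comm, smul_mul_assoc, Matrix.mul_one,
      basisMat_mul_conjTranspose]
  rw [e]
  refine PosSemidef.mul_mul_conjTranspose_same (PosSemidef.diagonal fun j => ?_) _
  exact Complex.zero_le_real.2 (sub_nonneg.2 (h j))

/-- A positive operator is bounded by its trace. -/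
lemma re_dotProduct_mulVec_le {σ : QubitOp κ} (hσ : σ.PosSemidef) (v : (κ → Fin 2) → ℂ) :
    (star v ⬝ᵥ σ.mulVec v).re ≤ σ.trace.re * ∑ x, ‖v x‖ ^ 2 := by
  obtain ⟨B, rfl⟩ := exists_eq_mul_conjTranspose hσ
  have h1 : star v ⬝ᵥ (B * Bᴴ).mulVec v = star (Bᴴ.mulVec v) ⬝ᵥ Bᴴ.mulVec v := by
    rw [star_mulVec, conjTranspose_conjTranspose, ← mulVec_mulVec, dotProduct_mulVec]
  rw [h1, trace_mul_comm, re_trace_conjTranspose_mul_self, Finset.sum_mul, dotProduct,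
    Complex.re_sum]
  refine Finset.sum_le_sum fun i _ => ?_
  rw [Pi.star_apply, Complex.star_def, ← Complex.normSq_eq_conj_mul_self, Complex.ofReal_re,
    Complex.normSq_eq_norm_sq]
  have h2 : ‖Bᴴ.mulVec v i‖ ≤ ∑ k, ‖B k i‖ * ‖v k‖ :=
    (norm_sum_le _ _).trans (le_of_eq (by simp))
  exact (pow_le_pow_left₀ (norm_nonneg _) h2 2).trans (Finset.sum_mul_sq_le_sq_mul_sq _ _ _)

lemma bornWeight_le_of_projected (N : QubitPM) {σ Q : QubitOp κ} (hσ : σ.PosSemidef)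
    (hQ : Qᴴ = Q) (hQσ : Q * σ * Q = σ) (j : κ → Fin 2) :
    bornWeight N σ j ≤ σ.trace.re * ∑ x, ‖Q.mulVec (prodVec N j) x‖ ^ 2 := by
  refine le_trans (le_of_eq ?_) (re_dotProduct_mulVec_le hσ (Q.mulVec (prodVec N j)))
  rw [bornWeight]
  congr 1
  conv_lhs => rw [← hQσ, ← mulVec_mulVec, ← mulVec_mulVec]
  rw [dotProduct_mulVec, star_mulVec, hQ]

/-- A state that measurement of all qubits with `M` finds in `J` with probability `s` has smooth
min-entropy at least `-n log c - log |J|` with respect to `N`: project it onto the span of `J`. -/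
lemma le_smoothMinEntropyPM (M N : QubitPM) {ρ : QubitOp κ} (hρ : IsDensity ρ)
    (J : Finset (κ → Fin 2)) {s η : ℝ} (hs : 0 < s) (hsJ : ∑ j ∈ J, bornWeight M ρ j = s)
    (hη : 2 * √(1 - s) ≤ η) :
    -((Fintype.card κ : ℝ) * Real.logb 2 (overlap M N)) - Real.logb 2 J.card
      ≤ smoothMinEntropyPM η N ρ := by
  obtain ⟨Q, hQ⟩ : ∃ Q, Q = labelProj M J := ⟨_, rfl⟩
  set σ : QubitOp κ := (s : ℂ)⁻¹ • (Q * ρ * Q) with hσ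
  have hQH : Qᴴ = Q := by rw [hQ, labelProj_conjTranspose]
  have hQQ : Q * Q = Q := by rw [hQ, labelProj_mul_self]
  have htr : (Q * ρ).trace = (s : ℂ) := by rw [hQ, trace_labelProj_mul M J hρ.1, hsJ]
  have hsC : (s : ℂ) ≠ 0 := by exact_mod_cast hs.ne'
  have hpsd : σ.PosSemidef := by
    have h := hρ.1.mul_mul_conjTranspose_same Q
    rw [hQH] at h
    refine h.smul ?_
    rw [← Complex.ofReal_inv]
    exact Complex.zero_le_real.2 (by positivity)
  have hσd : IsDensity σ := by
    refine ⟨hpsd, ?_⟩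
    rw [hσ, trace_smul, trace_mul_comm, ← Matrix.mul_assoc, hQQ, htr, smul_eq_mul,
      inv_mul_cancel₀ hsC]
  have hJ : 0 < J.card := by
    rw [Finset.card_pos, Finset.nonempty_iff_ne_empty]
    rintro rfl
    simp at hsJ
    exact hs.ne hsJ
  have hJ' : (0 : ℝ) < J.card := by exact_mod_cast hJ
  have hc := overlap_pos M N
  have hw : ∀ j, bornWeight N σ j ≤ J.card * overlap M N ^ Fintype.card κ := by
    intro j
    refine (bornWeight_le_of_projected N hpsd hQH ?_ j).trans ?_
    · rw [hσ, mul_smul_comm, smul_mul_assoc, Matrix.mul_assoc Q ρ Q, ← Matrix.mul_assoc Q Q, hQQ,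
        Matrix.mul_assoc Q (ρ * Q) Q, Matrix.mul_assoc ρ Q Q, hQQ]
    · rw [hσd.2, Complex.one_re, one_mul]
      rw [hQ]
      exact sum_norm_labelProj_mulVec_sq_le M N J j
  have hmin := neg_logb_le_minEntropyPM N hσd (by positivity) hw
  rw [Real.logb_mul hJ'.ne' (by positivity), Real.logb_pow] at hmin
  have hball : σ ∈ densityBall η ρ :=
    ⟨hσd, (traceNorm_projected_sub_le hρ hQH hQQ hs htr).trans hη⟩
  have hbdd : BddAbove (minEntropyPM N '' densityBall η ρ) :=
    ⟨Fintype.card κ, by rintro _ ⟨τ, hτ, rfl⟩; exact minEntropyPM_le_card N hτ.1⟩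
  have := le_csSup hbdd (Set.mem_image_of_mem _ hball)
  unfold smoothMinEntropyPM
  linarith

end MinEntropy

/-! ### Post-measurement states -/

section PostMeasurement

variable {ι : Type*} [Fintype ι] [DecidableEq ι]

lemma sum_glue {R : Type*} [AddCommMonoid R] (t : Finset ι) (f : (ι → Fin 2) → R) :
    ∑ j, f j = ∑ u, ∑ x, f (glue t u x) := by
  rw [← Fintype.sum_prod_type' (f := fun u x => f (glue t u x))]
  exact ((Equiv.piEquivPiSubtypeProd (· ∈ t) fun _ => Fin 2).symm.sum_comp f).symm

omit [Fintype ι] in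
lemma glue_restrict_mem (t : Finset ι) (u : {i // i ∈ t} → Fin 2) (x : {i // i ∉ t} → Fin 2) :
    (fun i : {i // i ∈ t} => glue t u x i) = u := by
  ext1 i; simp [glue, i.2]

omit [Fintype ι] in
lemma glue_restrict_notMem (t : Finset ι) (u : {i // i ∈ t} → Fin 2)
    (x : {i // i ∉ t} → Fin 2) : (fun i : {i // i ∉ t} => glue t u x i) = x := by
  ext1 i; simp [glue, i.2]

lemma prodVec_glue (M : QubitPM) (t : Finset ι) (q u : {i // i ∈ t} → Fin 2)
    (x y : {i // i ∉ t} → Fin 2) :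
    prodVec M (glue t q x) (glue t u y) = prodVec M q u * prodVec M x y := by
  unfold prodVec
  rw [← Fintype.prod_subtype_mul_prod_subtype (· ∈ t)]
  congr 1
  · exact Finset.prod_congr (by ext; simp) fun i _ => by simp [glue, i.2]
  · exact Finset.prod_congr rfl fun i _ => by simp [glue, i.2]

/-- The isometry `|x⟩ ↦ |μ_q⟩ ⊗ |x⟩`. -/
def embedOutcome (M : QubitPM) (t : Finset ι) (q : {i // i ∈ t} → Fin 2) :
    Matrix (ι → Fin 2) ({i // i ∉ t} → Fin 2) ℂ :=
  Matrix.of fun Y y =>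
    if (fun i : {i // i ∉ t} => Y i) = y then prodVec M q (fun i : {i // i ∈ t} => Y i) else 0

lemma subnormPost_eq (M : QubitPM) (ρ : QubitOp ι) (t : Finset ι) (q : {i // i ∈ t} → Fin 2) :
    subnormPost M ρ t q = (embedOutcome M t q)ᴴ * ρ * embedOutcome M t q := by
  ext x y
  simp only [mul_apply, conjTranspose_apply, embedOutcome, of_apply, sum_glue t,
    glue_restrict_mem, glue_restrict_notMem, apply_ite star, star_zero, ite_mul, mul_ite, mul_zero,
    zero_mul, Finset.sum_ite_eq', Finset.mem_univ, if_true, Finset.sum_mul]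
  rw [subnormPost, Finset.sum_comm]

lemma embedOutcome_mulVec_prodVec (M : QubitPM) (t : Finset ι) (q : {i // i ∈ t} → Fin 2)
    (x : {i // i ∉ t} → Fin 2) :
    (embedOutcome M t q).mulVec (prodVec M x) = prodVec M (glue t q x) := by
  ext Y
  have hY : Y = glue t (fun i : {i // i ∈ t} => Y i) (fun i : {i // i ∉ t} => Y i) := by
    ext1 i; by_cases h : i ∈ t <;> simp [glue, h]
  conv_rhs => rw [hY, prodVec_glue]
  simp [mulVec, dotProduct, embedOutcome]

lemma bornWeight_subnormPost (M : QubitPM) (ρ : QubitOp ι) (t : Finset ι)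
    (q : {i // i ∈ t} → Fin 2) (x : {i // i ∉ t} → Fin 2) :
    bornWeight M (subnormPost M ρ t q) x = bornWeight M ρ (glue t q x) := by
  rw [bornWeight, bornWeight, subnormPost_eq, ← mulVec_mulVec, ← mulVec_mulVec, dotProduct_mulVec,
    ← star_mulVec, embedOutcome_mulVec_prodVec]

lemma posSemidef_subnormPost (M : QubitPM) {ρ : QubitOp ι} (hρ : ρ.PosSemidef) (t : Finset ι)
    (q : {i // i ∈ t} → Fin 2) : (subnormPost M ρ t q).PosSemidef := by
  rw [subnormPost_eq]
  exact hρ.conjTranspose_mul_mul_same _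

lemma outcomeProb_eq (M : QubitPM) (ρ : QubitOp ι) (t : Finset ι) (q : {i // i ∈ t} → Fin 2) :
    outcomeProb M ρ t q = ∑ x, bornWeight M ρ (glue t q x) := by
  rw [outcomeProb, ← sum_bornWeight M]
  simp only [bornWeight_subnormPost]

lemma outcomeProb_nonneg (M : QubitPM) {ρ : QubitOp ι} (hρ : ρ.PosSemidef) (t : Finset ι)
    (q : {i // i ∈ t} → Fin 2) : 0 ≤ outcomeProb M ρ t q := by
  rw [outcomeProb_eq]
  exact Finset.sum_nonneg fun x _ => bornWeight_nonneg M hρ _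

lemma isDensity_postState (M : QubitPM) {ρ : QubitOp ι} (hρ : ρ.PosSemidef) (t : Finset ι)
    (q : {i // i ∈ t} → Fin 2) (hp : 0 < outcomeProb M ρ t q) :
    IsDensity (postState M ρ t q) := by
  have hpsd := posSemidef_subnormPost M hρ t q
  have htr : (subnormPost M ρ t q).trace = (outcomeProb M ρ t q : ℂ) :=
    Complex.eq_re_of_ofReal_le (r := 0) (by simpa using hpsd.trace_nonneg)
  refine ⟨hpsd.smul ?_, ?_⟩
  · rw [← Complex.ofReal_inv]
    exact Complex.zero_le_real.2 (by positivity)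
  · rw [postState, trace_smul, htr, smul_eq_mul, inv_mul_cancel₀]
    exact_mod_cast hp.ne'

lemma bornWeight_postState (M : QubitPM) (ρ : QubitOp ι) (t : Finset ι)
    (q : {i // i ∈ t} → Fin 2) (x : {i // i ∉ t} → Fin 2) :
    bornWeight M (postState M ρ t q) x
      = (outcomeProb M ρ t q)⁻¹ * bornWeight M ρ (glue t q x) := by
  rw [postState, ← Complex.ofReal_inv, bornWeight_smul, bornWeight_subnormPost]

/-- The probability that all qubits are measured with `M`, the outcome on `t` is `q`, and the
outcome outside `t` has relative weight more than `w`. -/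
def heavyProb (M : QubitPM) (ρ : QubitOp ι) (a : Fin 2) (t : Finset ι) (q : {i // i ∈ t} → Fin 2)
    (w : ℝ) : ℝ :=
  ∑ x, if w < relWeight a x then bornWeight M ρ (glue t q x) else 0

lemma heavyProb_nonneg (M : QubitPM) {ρ : QubitOp ι} (hρ : ρ.PosSemidef) (a : Fin 2)
    (t : Finset ι) (q : {i // i ∈ t} → Fin 2) (w : ℝ) : 0 ≤ heavyProb M ρ a t q w :=
  Finset.sum_nonneg fun x _ => by split_ifs; exacts [bornWeight_nonneg M hρ _, le_rfl]

/-- If, conditioned on the outcome `q`, heavy strings have probability `x < 1`, then the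
post-measurement state is `2 √x`-close to a state supported on the span of the light strings. -/
lemma le_smoothMinEntropyPM_postState (M N : QubitPM) {ρ : QubitOp ι} (hρ : IsDensity ρ)
    (a : Fin 2) (t : Finset ι) (q : {i // i ∈ t} → Fin 2) {w x η : ℝ} (hw : 0 ≤ w) (hx : x < 1)
    (hη : 2 * √x ≤ η) (h : heavyProb M ρ a t q w < outcomeProb M ρ t q * x) :
    -((Fintype.card {i // i ∉ t} : ℝ) * Real.logb 2 (overlap M N)) ≤
      smoothMinEntropyPM η N (postState M ρ t q)
        + (Fintype.card {i // i ∉ t} : ℝ) * extBinEntropy w := by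
  have hp : 0 < outcomeProb M ρ t q := by
    refine (outcomeProb_nonneg M hρ.1 t q).lt_of_ne fun h0 => ?_
    rw [← h0, zero_mul] at h
    exact h.not_ge (heavyProb_nonneg M hρ.1 a t q w)
  set p := outcomeProb M ρ t q with hp_def
  have hd := isDensity_postState M hρ.1 t q hp
  set J : Finset ({i // i ∉ t} → Fin 2) := Finset.univ.filter fun b => relWeight a b ≤ w with hJ
  obtain ⟨s, hs⟩ : ∃ s, ∑ j ∈ J, bornWeight M (postState M ρ t q) j = s := ⟨_, rfl⟩
  have hs1 : s = 1 - p⁻¹ * heavyProb M ρ a t q w := by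
    have hsplit : ∑ j ∈ J, bornWeight M ρ (glue t q j) + heavyProb M ρ a t q w = p := by
      rw [hp_def, outcomeProb_eq, heavyProb, hJ, Finset.sum_filter, ← Finset.sum_add_distrib]
      refine Finset.sum_congr rfl fun b _ => ?_
      by_cases hb : relWeight a b ≤ w
      · simp [hb, hb.not_gt]
      · simp [hb, not_le.1 hb]
    rw [← hs]
    simp only [bornWeight_postState]
    rw [← Finset.mul_sum, ← hp_def, eq_sub_iff_add_eq, ← mul_add, hsplit, inv_mul_cancel₀ hp.ne']
  have hsx : 1 - s < x := by
    rw [hs1, sub_sub_cancel, inv_mul_lt_iff₀ hp]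
    exact h
  have hs0 : 0 < s := by linarith
  have hmain := le_smoothMinEntropyPM M N hd J hs0 hs
    ((mul_le_mul_of_nonneg_left (Real.sqrt_le_sqrt hsx.le) zero_le_two).trans hη)
  have hJpos : 0 < (J.card : ℝ) := by
    rw [Nat.cast_pos, Finset.card_pos, Finset.nonempty_iff_ne_empty]
    intro h0
    rw [h0, Finset.sum_empty] at hs
    exact hs0.ne hs
  have hcard := Real.logb_le_logb_of_le one_lt_two hJpos (card_hamming_ball_le a hw)
  rw [Real.logb_rpow zero_lt_two (by norm_num)] at hcard
  linarith

/-- Averaged over the sample, heavy strings have probability at most `ε²`: measuring all qubits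
with `M` turns the claim into the classical one. -/
lemma sum_heavyProb_le {m n : ℕ} (hι : Fintype.card ι = m + n) (hm : 1 ≤ m)
    (hmn : m ≤ n) {ε : ℝ} (hε : 0 < ε) (hε1 : ε ≤ 1) (a : Fin 2) (M : QubitPM) {ρ : QubitOp ι}
    (hρ : IsDensity ρ) :
    ∑ t ∈ Finset.powersetCard m (Finset.univ : Finset ι),
      ∑ q, heavyProb M ρ a t q (relWeight a q + samplingDelta m n ε)
      ≤ ((m + n).choose m : ℝ) * ε ^ 2 := by
  have h1 : ∀ t : Finset ι,
      ∑ q, heavyProb M ρ a t q (relWeight a q + samplingDelta m n ε)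
        = ∑ j, bornWeight M ρ j * (if relWeight a (fun i : {i // i ∈ t} => j i)
          + samplingDelta m n ε < relWeight a (fun i : {i // i ∉ t} => j i) then 1 else 0) := by
    intro t
    rw [sum_glue t]
    simp only [heavyProb, glue_restrict_mem, glue_restrict_notMem, mul_ite, mul_one, mul_zero]
  simp only [h1]
  rw [Finset.sum_comm]
  simp only [← Finset.mul_sum]
  refine (Finset.sum_le_sum fun j _ => mul_le_mul_of_nonneg_left
    (card_bad_samples_le hι hm hmn hε hε1 a j) (bornWeight_nonneg M hρ.1 j)).trans ?_
  rw [← Finset.sum_mul, sum_bornWeight, hρ.2, Complex.one_re, one_mul]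

lemma sampleProb_nonneg (m : ℕ) (M : QubitPM) {ρ : QubitOp ι} (hρ : ρ.PosSemidef)
    (E : (t : Finset ι) → ({i // i ∈ t} → Fin 2) → Prop) : 0 ≤ sampleProb m M ρ E := by
  refine Finset.sum_nonneg fun t _ => mul_nonneg (by positivity)
    (Finset.sum_nonneg fun q _ => ?_)
  split_ifs
  exacts [outcomeProb_nonneg M hρ t q, le_rfl]

/-- Markov's inequality for the conditional probability of heavy strings. -/
lemma one_sub_le_sampleProb {m n : ℕ} (hι : Fintype.card ι = m + n) (hm : 1 ≤ m)
    (hmn : m ≤ n) {ε : ℝ} (hε : 0 < ε) (hε1 : ε ≤ 1) (a : Fin 2) (M : QubitPM) {ρ : QubitOp ι}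
    (hρ : IsDensity ρ) {x : ℝ} (hx : 0 < x)
    (E : (t : Finset ι) → ({i // i ∈ t} → Fin 2) → Prop)
    (hE : ∀ t ∈ Finset.powersetCard m (Finset.univ : Finset ι), ∀ q,
      heavyProb M ρ a t q (relWeight a q + samplingDelta m n ε) < outcomeProb M ρ t q * x →
        E t q) :
    1 - x⁻¹ * ε ^ 2 ≤ sampleProb m M ρ E := by
  set c : ℝ := ((m + n).choose m : ℝ) with hc
  have hc0 : 0 < c := by rw [hc]; exact_mod_cast Nat.choose_pos (Nat.le_add_right m n)
  have hheavy := sum_heavyProb_le hι hm hmn hε hε1 a M hρ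
  set S := Finset.powersetCard m (Finset.univ : Finset ι) with hS
  have htot : ∀ t : Finset ι, ∑ q, outcomeProb M ρ t q = 1 := by
    intro t
    simp only [outcomeProb_eq]
    rw [← sum_glue t, sum_bornWeight, hρ.2, Complex.one_re]
  have hterm : ∀ t ∈ S,
      c⁻¹ * (1 - x⁻¹ * ∑ q, heavyProb M ρ a t q (relWeight a q + samplingDelta m n ε)) ≤
        c⁻¹ * ∑ q, open Classical in if E t q then outcomeProb M ρ t q else 0 := by
    intro t ht
    refine mul_le_mul_of_nonneg_left ?_ (by positivity)
    rw [← htot t, Finset.mul_sum, ← Finset.sum_sub_distrib]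
    refine Finset.sum_le_sum fun q _ => ?_
    have hnn := heavyProb_nonneg M hρ.1 a t q (relWeight a q + samplingDelta m n ε)
    split_ifs with h
    · have : 0 ≤ x⁻¹ * heavyProb M ρ a t q (relWeight a q + samplingDelta m n ε) := by positivity
      linarith
    · have h2 := not_lt.1 (mt (hE t ht q) h)
      rw [sub_nonpos, le_inv_mul_iff₀ hx, mul_comm]
      exact h2
  have hsum := Finset.sum_le_sum hterm
  rw [← Finset.mul_sum, Finset.sum_sub_distrib, Finset.sum_const, ← Finset.mul_sum, nsmul_eq_mul,
    mul_one, hS, Finset.card_powersetCard, Finset.card_univ, hι, ← hc, ← hS] at hsum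
  rw [sampleProb, hι]
  refine le_trans ?_ hsum
  have h3 : x⁻¹ * ∑ t ∈ S, ∑ q, heavyProb M ρ a t q (relWeight a q + samplingDelta m n ε)
      ≤ x⁻¹ * (c * ε ^ 2) := mul_le_mul_of_nonneg_left hheavy (by positivity)
  rw [le_inv_mul_iff₀ hc0]
  nlinarith

end PostMeasurement

end QuantumSampling
end

theorem theorem1 (m n : ℕ) (hm : 1 ≤ m) (hmn : m ≤ n)
    (εhat ε β : ℝ) (hε : 0 < ε) (hεhat : ε ≤ εhat) (hβ0 : 0 < β) (hβ : β < 1 / 2)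
    (a : Fin 2) (M N : QuantumSampling.QubitPM)
    (ρ : QuantumSampling.QubitOp (Fin (m + n))) (hρ : QuantumSampling.IsDensity ρ) :
    QuantumSampling.sampleProb m M ρ (fun t q =>
        QuantumSampling.smoothMinEntropyPM (2 * ε + 2 * ε ^ β) N
            (QuantumSampling.postState M ρ t q)
          + (n : ℝ) * QuantumSampling.extBinEntropy
              (QuantumSampling.relWeight a q + QuantumSampling.samplingDelta m n ε)
          ≥ -((n : ℝ) * Real.logb 2 (QuantumSampling.overlap M N)))
      ≥ 1 - εhat ^ (1 - 2 * β) := by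
  rcases le_or_gt 1 ε with h1 | h1
  · -- the right-hand side is not positive
    have h2 := Real.one_le_rpow (h1.trans hεhat) (show 0 ≤ 1 - 2 * β by linarith)
    have h3 := QuantumSampling.sampleProb_nonneg m M hρ.1 fun t q =>
        QuantumSampling.smoothMinEntropyPM (2 * ε + 2 * ε ^ β) N
            (QuantumSampling.postState M ρ t q)
          + (n : ℝ) * QuantumSampling.extBinEntropy
              (QuantumSampling.relWeight a q + QuantumSampling.samplingDelta m n ε)
          ≥ -((n : ℝ) * Real.logb 2 (QuantumSampling.overlap M N))
    linarith
  -- Markov's inequality at the threshold `ε ^ (2 β)`, which gives smoothing radius `2 ε ^ β`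
  have hx : 0 < ε ^ (2 * β) := Real.rpow_pos_of_pos hε _
  have hsqrt : √(ε ^ (2 * β)) = ε ^ β := by
    rw [mul_comm, Real.rpow_mul hε.le, Real.rpow_two, Real.sqrt_sq (Real.rpow_nonneg hε.le _)]
  have hfail : (ε ^ (2 * β))⁻¹ * ε ^ 2 ≤ εhat ^ (1 - 2 * β) := by
    calc (ε ^ (2 * β))⁻¹ * ε ^ 2 = ε ^ (2 - 2 * β) := by
          rw [Real.rpow_sub hε, Real.rpow_two, div_eq_inv_mul]
      _ ≤ ε ^ (1 - 2 * β) := Real.rpow_le_rpow_of_exponent_ge hε h1.le (by linarith)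
      _ ≤ _ := Real.rpow_le_rpow hε.le hεhat (by linarith)
  refine ge_iff_le.2 (le_trans (by linarith) (QuantumSampling.one_sub_le_sampleProb
    (Fintype.card_fin _) hm hmn hε h1.le a M hρ hx _ fun t ht q hq => ?_))
  have hcard : Fintype.card {i // i ∉ t} = n := by
    rw [Fintype.card_subtype_compl, Fintype.card_fin, Fintype.card_coe,
      (Finset.mem_powersetCard.1 ht).2, Nat.add_sub_cancel_left]
  have hw : 0 ≤ QuantumSampling.relWeight a q + QuantumSampling.samplingDelta m n ε :=
    add_nonneg (div_nonneg (Nat.cast_nonneg _) (Nat.cast_nonneg _)) (Real.sqrt_nonneg _)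
  have h := QuantumSampling.le_smoothMinEntropyPM_postState M N hρ a t q hw
    (Real.rpow_lt_one hε.le h1 (by linarith))
    (show 2 * √(ε ^ (2 * β)) ≤ 2 * ε + 2 * ε ^ β by rw [hsqrt]; linarith) hq
  rwa [hcard] at h
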